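/- Let $X$ be a real Banach space. For an operator (relation) $A\subseteq X\times X$ put $\operatorname{dom}A=\{x: \exists f,\ (x,f)\in A\}$ and $|Ax|:=\inf\{\|f\|: (x,f)\in A\}$ (with $\inf\emptyset=\infty$). Let $\omega\in\mathbb R$. The operator $A$ is $m$-accretive of type $\omega$ if for every $\lambda>0$ with $\lambda\omega<1$ one has $\|x-\hat x+\lambda(f-\hat f)\|\ge(1-\lambda\omega)\|x-\hat x\|$ for all $(x,f),(\hat x,\hat f)\in A$, and $I+\lambda A$ is onto $X$. Let $A$ be such an operator, and let $S$ be the semigroup on $\overline{\operatorname{dom}A}$ generated by $-A$, that is, $t\mapsto S(t)x$ is the mild solution on $[0,\infty)$ of $\dot u+Au\ni0$, $u(0)=x$. Let $$K(x,t)=\inf_{v\in X}\big(\|x-v\|+t\,|Av|\big)\qquad(x\in X,\ t>0).$$ Assume that $S$ is regularizing: $S(t)$ maps $\overline{\operatorname{dom}A}$ into $\operatorname{dom}A$ for every $t>0$, and there are $C\ge0$, $\tau_0>0$ such that $|AS(t)x|\le C\,K(x,t)/t$ for all $t\in(0,\tau_0)$ and $x\in\overline{\operatorname{dom}A}$. Assume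 also that $t\mapsto|AS(t)x|$ is measurable on $(0,\infty)$ for every $x\in\overline{\operatorname{dom} A}$. Let $E$ be a Banach function space over $(0,\infty)$, that is, a Banach space of classes of measurable functions with $L^1\cap L^\infty(0,\infty)\subseteq E\subseteq L^1+L^\infty(0,\infty)$ such that $|g|\le|f|$ and $f\in E$ imply $g\in E$ and $\|g\|_E\le\|f\|_E$; put $\|f\|_E:=\infty$ if $f\notin E$. Assume that the Hardy operator $Pf(t)=\frac1t\int_0^tf(s)\,ds$ is bounded on $E$, and for $\tau>0$ let $$(\mathcal N^A)^\tau_E(x)=\Big\|t\mapsto \frac{K(x,t)}t\,\chi_{(0,\tau)}(t)\Big\|_E .$$ Then for every $\tau>0$ there is a constant $M>0$, depending only on $\omega$, $C$, $\tau_0$ and $\tau$, such that for every $x\in\overline{\operatorname{dom}A}$ $$\frac{1}{e^{\max(\omega,0)\,\tau}\,\|P\|_{\mathcal L(E)}+1}\,(\mathcal N^A)^\tau_E(x)\ \le\ \big\|t\mapsto|AS(t)x|\,\chi_{(0,\tau)}(t)\big\|_E\ \le\ M\,(\mathcal N^A)^\tau_E(x),$$ and if $\tau\le\tau_0$ the second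 inequality also holds with $C$ in place of $M$. In particular, $$\{x\in X: (\mathcal N^A)^\tau_E(x)<\infty\}=\{x\in\overline{\operatorname{dom}A}:\ t\mapsto|AS(t)x|\,\chi_{(0,\tau)}(t)\in E\}.$$ -/

import Mathlib

open MeasureTheory Set Filter Topology
open scoped ENNReal

namespace NonlinearInterpolation

/-! ### Banach function spaces over the half-line -/

/-- Lebesgue measure on the half-line `(0, ∞)`. -/
noncomputable def halfLine : Measure ℝ := volume.restrict (Ioi 0)

/-- A Banach function space over `(0, ∞)`: a complete normed space of (classes of) measurable
functions lying between `L¹ ∩ L^∞` and `L¹ + L^∞`, which is an order ideal with monotone norm. -/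
structure BanachFunctionSpace where
  carrier : Submodule ℝ (ℝ →ₘ[halfLine] ℝ)
  norm : Seminorm ℝ carrier
  norm_definite : ∀ f : carrier, norm f = 0 → f = 0
  complete : ∀ u : ℕ → carrier,
    (∀ ε : ℝ, 0 < ε → ∃ N : ℕ, ∀ m n : ℕ, N ≤ m → N ≤ n → norm (u m - u n) < ε) →
      ∃ f : carrier, Tendsto (fun n => norm (u n - f)) atTop (𝓝 0)
  inter_le : ∀ f : ℝ →ₘ[halfLine] ℝ, MemLp f 1 halfLine → MemLp f ∞ halfLine → f ∈ carrier
  le_sum : ∀ f ∈ carrier, ∃ g h : ℝ →ₘ[halfLine] ℝ,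
    MemLp g 1 halfLine ∧ MemLp h ∞ halfLine ∧ f = g + h
  ideal : ∀ (f : carrier) (g : ℝ →ₘ[halfLine] ℝ),
    (∀ᵐ t ∂halfLine, |g t| ≤ |(f : ℝ →ₘ[halfLine] ℝ) t|) →
      ∃ hg : g ∈ carrier, norm ⟨g, hg⟩ ≤ norm f

namespace BanachFunctionSpace

variable (E : BanachFunctionSpace)

/-- The element `g` of `E` is the class of the `[0, ∞]`-valued function `F`. -/
def Represents (g : E.carrier) (F : ℝ → ℝ≥0∞) : Prop :=
  ∀ᵐ t ∂halfLine, 0 ≤ (g : ℝ →ₘ[halfLine] ℝ) t ∧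
    F t = ENNReal.ofReal ((g : ℝ →ₘ[halfLine] ℝ) t)

/-- A `[0, ∞]`-valued function on the half-line belongs to `E`. -/
def Mem (F : ℝ → ℝ≥0∞) : Prop := ∃ g : E.carrier, E.Represents g F

/-- The `E`-norm of a `[0, ∞]`-valued function; it is `∞` if the function is not in `E`
(and otherwise the infimum runs over one element of `E`). -/
noncomputable def eNorm (F : ℝ → ℝ≥0∞) : ℝ≥0∞ :=
  ⨅ (g : E.carrier) (_ : E.Represents g F), ENNReal.ofReal (E.norm g)

end BanachFunctionSpace

/-- The Hardy operator `(P f)(t) = (1 / t) ∫₀ᵗ f(s) ds`. -/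
noncomputable def hardy (f : ℝ → ℝ) (t : ℝ) : ℝ := t⁻¹ * ∫ s in (0 : ℝ)..t, f s

/-- The Hardy operator maps `E` into `E`, with bound `M`. -/
def IsHardyBound (E : BanachFunctionSpace) (M : ℝ) : Prop :=
  ∀ f : E.carrier, ∃ g : E.carrier,
    ((g : ℝ →ₘ[halfLine] ℝ) =ᵐ[halfLine] hardy (f : ℝ →ₘ[halfLine] ℝ)) ∧
      E.norm g ≤ M * E.norm f

/-- The Hardy operator is bounded on `E`. -/
def HardyBounded (E : BanachFunctionSpace) : Prop := ∃ M : ℝ, IsHardyBound E M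

/-- The operator norm of the Hardy operator on `E`. -/
noncomputable def hardyNorm (E : BanachFunctionSpace) : ℝ :=
  sInf {M : ℝ | 0 ≤ M ∧ IsHardyBound E M}

/-! ### The `K`-method for functions -/

section KMethod

variable {X : Type*} [NormedAddCommGroup X]

/-- The `K`-function of a couple `(N₀, N₁)` of `[0, ∞]`-valued functions. -/
noncomputable def kFun (N₀ N₁ : X → ℝ≥0∞) (x : X) (t : ℝ) : ℝ≥0∞ :=
  ⨅ v : X, N₀ (x - v) + ENNReal.ofReal t * N₁ v

/-- The finite interpolation function `x ↦ ‖t ↦ (K(x,t)/t) χ_{(0,τ)}(t)‖_E`. -/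
noncomputable def kInterp (N₀ N₁ : X → ℝ≥0∞) (E : BanachFunctionSpace) (τ : ℝ) (x : X) : ℝ≥0∞ :=
  E.eNorm ((Ioo 0 τ).indicator fun t => kFun N₀ N₁ x t / ENNReal.ofReal t)

end KMethod

/-! ### Accretive operators and their semigroups -/

section Operators

variable {X : Type*} [NormedAddCommGroup X]

/-- The domain of an operator (relation) `A ⊆ X × X`. -/
def dom (A : Set (X × X)) : Set X := {x | ∃ f, (x, f) ∈ A}

/-- The set norm `|A x| = inf {‖f‖ : (x, f) ∈ A}`, equal to `∞` outside the domain. -/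
noncomputable def setNorm (A : Set (X × X)) (x : X) : ℝ≥0∞ := ⨅ (f : X) (_ : (x, f) ∈ A), ‖f‖ₑ

variable [NormedSpace ℝ X]

/-- `A` is accretive of type `ω`. -/
def IsAccretive (ω : ℝ) (A : Set (X × X)) : Prop :=
  ∀ p ∈ A, ∀ q ∈ A, ∀ l : ℝ, 0 < l → l * ω < 1 →
    (1 - l * ω) * ‖p.1 - q.1‖ ≤ ‖p.1 - q.1 + l • (p.2 - q.2)‖

/-- `A` is `m`-accretive of type `ω`: accretive of type `ω`, and `I + l A` is onto `X` for every
`l > 0` with `l ω < 1`. -/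
def IsMAccretive (ω : ℝ) (A : Set (X × X)) : Prop :=
  IsAccretive ω A ∧ ∀ l : ℝ, 0 < l → l * ω < 1 → ∀ y : X, ∃ p ∈ A, p.1 + l • p.2 = y

/-- On `[0, T]` the function `u` is `ε`-close to an `ε`-approximate solution of
`u' + A u ∋ 0`, `u(0) = x`: a step function with value `z (i+1)` on `(t i, t (i+1)]` that solves
the implicit Euler scheme
`(z (i+1) - z i) / (t (i+1) - t i) + A (z (i+1)) ∋ f (i+1)`
on a mesh of width at most `ε`, with an error `f` of `L¹`-norm at most `ε`. -/
def HasEulerApprox (A : Set (X × X)) (x : X) (T ε : ℝ) (u : ℝ → X) : Prop :=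
  ∃ (N : ℕ) (t : ℕ → ℝ) (z f : ℕ → X),
    t 0 = 0 ∧ T - ε < t N ∧ t N ≤ T ∧
    (∀ i < N, t i < t (i + 1) ∧ t (i + 1) - t i ≤ ε) ∧
    ∑ i ∈ Finset.range N, (t (i + 1) - t i) * ‖f (i + 1)‖ ≤ ε ∧
    (∀ i < N, (z (i + 1), f (i + 1) - (t (i + 1) - t i)⁻¹ • (z (i + 1) - z i)) ∈ A) ∧
    ‖z 0 - x‖ ≤ ε ∧
    ∀ i < N, ∀ s ∈ Ioc (t i) (t (i + 1)), ‖u s - z (i + 1)‖ ≤ ε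

/-- `u` is a mild solution on `[0, ∞)` of `u' + A u ∋ 0`, `u(0) = x`. -/
def IsMildSolution (A : Set (X × X)) (x : X) (u : ℝ → X) : Prop :=
  ContinuousOn u (Ici 0) ∧ u 0 = x ∧
    ∀ T : ℝ, 0 < T → ∀ ε : ℝ, 0 < ε → HasEulerApprox A x T ε u

/-- `S` is the semigroup on the closure of `dom A` generated by `-A`: its orbits are the mild
solutions. (The values of `S t` outside the closure of `dom A` and for `t < 0` are irrelevant.) -/
def IsGeneratedBy (A : Set (X × X)) (S : ℝ → X → X) : Prop :=
  ∀ x ∈ closure (dom A), IsMildSolution A x (fun t => S t x)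

/-- The `K`-function of the couple `(‖·‖, |A ·|)`. -/
noncomputable def opK (A : Set (X × X)) (x : X) (t : ℝ) : ℝ≥0∞ :=
  kFun (fun y => ‖y‖ₑ) (setNorm A) x t

/-- The finite interpolation function of the couple `(‖·‖, |A ·|)`. -/
noncomputable def opInterp (A : Set (X × X)) (E : BanachFunctionSpace) (τ : ℝ) (x : X) : ℝ≥0∞ :=
  kInterp (fun y => ‖y‖ₑ) (setNorm A) E τ x

/-- The semigroup `S` generated by `-A` is regularizing, with constant `C` on `(0, τ₀)`. -/
def IsRegularizingWith (A : Set (X × X)) (S : ℝ → X → X) (C τ₀ : ℝ) : Prop :=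
  (∀ t : ℝ, 0 < t → ∀ x ∈ closure (dom A), S t x ∈ dom A) ∧
    ∀ t ∈ Ioo 0 τ₀, ∀ x ∈ closure (dom A),
      setNorm A (S t x) ≤ ENNReal.ofReal C * (opK A x t / ENNReal.ofReal t)

/-- The function `t ↦ |A S(t) x| χ_{(0,τ)}(t)`. -/
noncomputable def orbitNorm (A : Set (X × X)) (S : ℝ → X → X) (τ : ℝ) (x : X) : ℝ → ℝ≥0∞ :=
  (Ioo 0 τ).indicator fun t => setNorm A (S t x)

end Operators

end NonlinearInterpolation

/-! Both inequalities are pointwise estimates in `t`, transferred to `E` by the ideal property.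

For the lower one, test the infimum defining `K(x,t)` with `v = S(t)x`. The term `t |A S(t)x|` is
harmless, and the displacement satisfies `‖S(t)x - x‖ ≤ ∫₀ᵗ |A S(s)x| ds`
(`IsMildSolution.enorm_sub_initial_le_lintegral`). Hence `K(x,t)/t ≤ |A S(t)x| + P(|A S(·)x|)(t)`.
The integral bound comes from `‖u(s+h) - u(s)‖ ≤ h e^{2ωh} |A u(s)|` with `ω ≥ 0`: averaging over
`s` and letting `h → 0` removes the exponential, so no differentiability of the orbit is needed.

The upper one is the regularizing hypothesis when `τ ≤ τ₀`. For larger times `K(S(t)x, s)` is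
bounded by a multiple of `K(x,s)`, and the last stretch of length `τ₀/2` is regularizing
(`exists_setNorm_orbit_le`). This needs the semigroup law, hence uniqueness of mild solutions, which
follows from comparing two implicit Euler schemes on different meshes (`double_index_comparison`,
`IsMildSolution.norm_sub_le`).

Finally, off the closure of the domain `K(x,t)/t ≥ c/t` with `c > 0`. This is not integrable at
zero, whereas elements of `E` are, so the interpolation function is infinite there. -/

namespace NonlinearInterpolation

/-! ### Accretivity estimates for implicit Euler schemes -/

section Euler

/-- Discrete comparison principle for the double-index recursion satisfied by the distance of two
implicit Euler schemes with step sizes `h` and `k`. -/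
theorem double_index_comparison {N N' : ℕ} {h k p q : ℕ → ℝ} {a : ℕ → ℕ → ℝ} {D L δ : ℝ}
    (hL : 0 ≤ L)
    (hh : ∀ i < N, 0 < h i ∧ h i ≤ δ) (hk : ∀ j < N', 0 < k j ∧ k j ≤ δ)
    (hp : ∀ i < N, 0 ≤ p i) (hq : ∀ j < N', 0 ≤ q j)
    (hrec : ∀ i < N, ∀ j < N', (h i + k j) * a (i + 1) (j + 1) ≤
      k j * a i (j + 1) + h i * a (i + 1) j + h i * k j * (p i + q j))
    (hleft : ∀ i ≤ N, a i 0 ≤ D + L * (∑ l ∈ Finset.range i, h l) ^ 2)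
    (hright : ∀ j ≤ N', a 0 j ≤ D + L * (∑ l ∈ Finset.range j, k l) ^ 2)
    (hδ : 0 ≤ δ) :
    ∀ i ≤ N, ∀ j ≤ N', a i j ≤ D
      + L * (∑ l ∈ Finset.range i, h l - ∑ l ∈ Finset.range j, k l) ^ 2
      + L * δ * (∑ l ∈ Finset.range i, h l + ∑ l ∈ Finset.range j, k l)
      + ∑ l ∈ Finset.range i, h l * p l + ∑ l ∈ Finset.range j, k l * q l := by
  have nonneg : ∀ {n : ℕ} {f : ℕ → ℝ} {m : ℕ}, (∀ i < n, 0 ≤ f i) → m ≤ n →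
      0 ≤ ∑ l ∈ Finset.range m, f l := fun hf hm =>
    Finset.sum_nonneg fun l hl => hf l ((Finset.mem_range.1 hl).trans_le hm)
  intro i
  induction i with
  | zero =>
    intro _ j hj
    have h1 := hright j hj
    have h2 : 0 ≤ ∑ l ∈ Finset.range j, k l := nonneg (fun l hl => (hk l hl).1.le) hj
    have h3 : 0 ≤ ∑ l ∈ Finset.range j, k l * q l :=
      nonneg (fun l hl => mul_nonneg (hk l hl).1.le (hq l hl)) hj
    have h4 := mul_nonneg (mul_nonneg hL hδ) h2
    simp only [Finset.range_zero, Finset.sum_empty]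
    linarith [h1, h3, h4]
  | succ i ih =>
    intro hi j
    induction j with
    | zero =>
      intro _
      have h1 := hleft _ hi
      have h2 : 0 ≤ ∑ l ∈ Finset.range (i + 1), h l := nonneg (fun l hl => (hh l hl).1.le) hi
      have h3 : 0 ≤ ∑ l ∈ Finset.range (i + 1), h l * p l :=
        nonneg (fun l hl => mul_nonneg (hh l hl).1.le (hp l hl)) hi
      have h4 := mul_nonneg (mul_nonneg hL hδ) h2
      rw [Finset.range_zero, Finset.sum_empty, Finset.sum_empty, sub_zero, add_zero, add_zero]
      linarith [h1, h3, h4]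
    | succ j ihj =>
      intro hj
      have h1 := ih (by omega) (j + 1) hj
      have h2 := ihj (by omega)
      have h3 := hrec i (by omega) j (by omega)
      obtain ⟨hi0, hi1⟩ := hh i (by omega)
      obtain ⟨hj0, hj1⟩ := hk j (by omega)
      simp only [Finset.sum_range_succ] at h1 h2 ⊢
      set s := ∑ l ∈ Finset.range i, h l
      set r := ∑ l ∈ Finset.range j, k l
      set P := ∑ l ∈ Finset.range i, h l * p l
      set Q := ∑ l ∈ Finset.range j, k l * q l
      have h4 := mul_le_mul_of_nonneg_left h1 hj0.le
      have h5 := mul_le_mul_of_nonneg_left h2 hi0.le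
      -- The weighted average of `L (s - r)²` over the two predecessors exceeds its value at the new
      -- node by `L h k (h + k)` (before division by `h + k`). The linear term `L δ (s + r)` loses
      -- `2 L δ h k`, which compensates since both steps are at most `δ`.
      have h6 : 0 ≤ L * (h i * k j) * ((δ - h i) + (δ - k j)) := by
        have := mul_pos hi0 hj0
        have : 0 ≤ (δ - h i) + (δ - k j) := by linarith
        positivity
      refine le_of_mul_le_mul_left ?_ (add_pos hi0 hj0)
      linarith [h3, h4, h5, h6]

variable {X : Type*} [NormedAddCommGroup X] [NormedSpace ℝ X]

theorem IsAccretive.mono {ω ω' : ℝ} {A : Set (X × X)} (hA : IsAccretive ω A) (hω : ω ≤ ω') :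
    IsAccretive ω' A := by
  intro p hp q hq l hl hlω
  have h1 : l * ω ≤ l * ω' := mul_le_mul_of_nonneg_left hω hl.le
  refine le_trans ?_ (hA p hp q hq l hl (by linarith))
  exact mul_le_mul_of_nonneg_right (by linarith) (norm_nonneg _)

/-- One step of an implicit Euler scheme against a fixed element of the operator. -/
theorem IsAccretive.step {ω : ℝ} {A : Set (X × X)} (hA : IsAccretive ω A) {x y z w f : X}
    (hxy : (x, y) ∈ A) {h : ℝ} (hh : 0 < h) (hω : h * ω < 1)
    (hz : (w, f - h⁻¹ • (w - z)) ∈ A) :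
    (1 - h * ω) * ‖w - x‖ ≤ ‖z - x‖ + h * ‖f‖ + h * ‖y‖ := by
  have h1 := hA _ hz _ hxy h hh hω
  have h2 : w - x + h • (f - h⁻¹ • (w - z) - y) = (z - x) + h • f - h • y := by
    rw [smul_sub, smul_sub, smul_inv_smul₀ hh.ne']
    abel
  refine h1.trans ?_
  simp only [h2]
  refine (norm_sub_le _ _).trans ?_
  refine add_le_add ((norm_add_le _ _).trans (add_le_add le_rfl ?_)) ?_ <;>
  rw [norm_smul, Real.norm_of_nonneg hh.le]

/-- One step of two implicit Euler schemes against each other. -/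
theorem IsAccretive.step_step {ω : ℝ} (hω0 : 0 ≤ ω) {A : Set (X × X)} (hA : IsAccretive ω A)
    {z w f z' w' f' : X} {h k : ℝ} (hh : 0 < h) (hk : 0 < k) (hω : h * ω < 1)
    (hz : (w, f - h⁻¹ • (w - z)) ∈ A) (hz' : (w', f' - k⁻¹ • (w' - z')) ∈ A) :
    (h + k * (1 - h * ω)) * ‖w - w'‖ ≤
      k * ‖z - w'‖ + h * ‖w - z'‖ + h * k * (‖f‖ + ‖f'‖) := by
  have hs : 0 < h + k := add_pos hh hk
  -- With this accretivity parameter the vectors `w` and `w'` recombine, after scaling by `h + k`,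
  -- into differences with one old and one new node.
  have hl : 0 < h * k / (h + k) := by positivity
  have hle : h * k / (h + k) ≤ h := by
    rw [div_le_iff₀ hs]
    nlinarith
  have h1 := hA _ hz _ hz' _ hl
    ((mul_le_mul_of_nonneg_right hle hω0).trans_lt hω)
  have h2 := mul_le_mul_of_nonneg_left h1 hs.le
  have h3 : (h + k) • (w - w' + (h * k / (h + k)) •
      (f - h⁻¹ • (w - z) - (f' - k⁻¹ • (w' - z')))) =
      k • (z - w') + h • (w - z') + (h * k) • (f - f') := by
    rw [smul_add, smul_smul, mul_div_cancel₀ _ hs.ne']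
    have e1 : (h * k) • (h⁻¹ • (w - z)) = k • (w - z) := by
      rw [smul_smul]; congr 1; field_simp
    have e2 : (h * k) • (k⁻¹ • (w' - z')) = h • (w' - z') := by
      rw [smul_smul]; congr 1; field_simp
    simp only [smul_sub (h * k), e1, e2]
    module
  have h4 : (h + k) * ‖w - w' + (h * k / (h + k)) •
      (f - h⁻¹ • (w - z) - (f' - k⁻¹ • (w' - z')))‖ ≤
      k * ‖z - w'‖ + h * ‖w - z'‖ + h * k * (‖f‖ + ‖f'‖) := by
    refine le_trans (le_of_eq ?_) (le_trans (le_of_eq (congrArg norm h3)) ?_)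
    · rw [norm_smul, Real.norm_of_nonneg hs.le]
    refine (norm_add_le _ _).trans (add_le_add ((norm_add_le _ _).trans (add_le_add ?_ ?_)) ?_)
    · rw [norm_smul, Real.norm_of_nonneg hk.le]
    · rw [norm_smul, Real.norm_of_nonneg hh.le]
    · rw [norm_smul, Real.norm_of_nonneg (mul_pos hh hk).le]
      exact mul_le_mul_of_nonneg_left (norm_sub_le _ _) (mul_pos hh hk).le
  refine le_trans (le_of_eq ?_) (h2.trans h4)
  field_simp
  ring

/-- On a short step, `(1 - h ω)⁻¹` is dominated by an exponential. -/
theorem one_le_one_sub_mul_exp {a : ℝ} (h0 : 0 ≤ a) (h1 : a ≤ 1 / 2) :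
    1 ≤ (1 - a) * Real.exp (2 * a) := by
  have := Real.add_one_le_exp (2 * a)
  nlinarith

/-- A time in `(0, t N]` lies in one of the intervals of the mesh. -/
theorem exists_mem_Ioc_mesh {N : ℕ} {t : ℕ → ℝ} {s : ℝ} (h0 : t 0 < s) (hN : s ≤ t N) :
    ∃ i < N, s ∈ Ioc (t i) (t (i + 1)) := by
  induction N with
  | zero => exact absurd (h0.trans_le hN) (lt_irrefl _)
  | succ n ih =>
    by_cases hs : s ≤ t n
    · obtain ⟨i, hi, h⟩ := ih hs
      exact ⟨i, by omega, h⟩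
    · exact ⟨n, by omega, not_le.1 hs, hN⟩

/-- A mesh with increasing nodes is monotone. -/
theorem mesh_mono {N : ℕ} {t : ℕ → ℝ} (h : ∀ i < N, t i < t (i + 1)) {i j : ℕ} (hij : i ≤ j)
    (hj : j ≤ N) : t i ≤ t j := by
  induction j, hij using Nat.le_induction with
  | base => exact le_rfl
  | succ j hij ih => exact (ih (by omega)).trans (h j (by omega)).le

/-- A function continuous on `[0, ∞)` stays within `η + L t²` of its initial value on compacts. -/
theorem exists_quadratic_modulus {Y : Type*} [NormedAddCommGroup Y] {u : ℝ → Y}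
    (hu : ContinuousOn u (Ici 0)) (T : ℝ) {η : ℝ} (hη : 0 < η) :
    ∃ L : ℝ, 0 ≤ L ∧ ∀ t ∈ Icc 0 T, ‖u t - u 0‖ ≤ η + L * t ^ 2 := by
  have hc : ContinuousOn (fun t => u t - u 0) (Icc 0 T) :=
    (hu.mono Icc_subset_Ici_self).sub continuousOn_const
  obtain ⟨B, hB⟩ := isCompact_Icc.exists_bound_of_continuousOn hc
  obtain ⟨δ, hδ, hδ'⟩ := Metric.continuousOn_iff.1 hu 0 (mem_Ici.2 le_rfl) η hη
  -- For `t ≥ δ` the quadratic term alone dominates the global bound `B`. A quadratic modulus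
  -- matches the boundary terms in `double_index_comparison`.
  refine ⟨|B| / δ ^ 2, by positivity, fun t ht => ?_⟩
  by_cases h : t < δ
  · have := hδ' t ht.1 (by rw [Real.dist_eq, sub_zero, abs_of_nonneg ht.1]; exact h)
    rw [dist_eq_norm] at this
    have : 0 ≤ |B| / δ ^ 2 * t ^ 2 := by positivity
    linarith
  · have h1 : |B| ≤ |B| / δ ^ 2 * t ^ 2 := by
      rw [div_mul_eq_mul_div, le_div_iff₀ (by positivity)]
      exact mul_le_mul_of_nonneg_left (pow_le_pow_left₀ hδ.le (not_lt.1 h) 2) (abs_nonneg _)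
    linarith [hB t ht, le_abs_self B]

end Euler

/-! ### Displacement and time shifts of mild solutions -/

section Mild

variable {X : Type*} [NormedAddCommGroup X]

theorem mesh_eq_sum {t : ℕ → ℝ} (h0 : t 0 = 0) (i : ℕ) :
    ∑ l ∈ Finset.range i, (t (l + 1) - t l) = t i := by
  rw [Finset.sum_range_sub, h0, sub_zero]

/-- Every node value of an Euler approximation is close to the approximated function. -/
theorem norm_node_sub_le {N : ℕ} {t : ℕ → ℝ} {z : ℕ → X} {u : ℝ → X} {x : X} {ε : ℝ}
    (h0 : t 0 = 0) (hu : u 0 = x) (hz : ‖z 0 - x‖ ≤ ε) (ht : ∀ i < N, t i < t (i + 1))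
    (hc : ∀ i < N, ∀ s ∈ Ioc (t i) (t (i + 1)), ‖u s - z (i + 1)‖ ≤ ε) {i : ℕ} (hi : i ≤ N) :
    ‖z i - u (t i)‖ ≤ ε := by
  cases i with
  | zero => rw [h0, hu]; exact hz
  | succ i => rw [norm_sub_rev]; exact hc i hi _ ⟨ht i hi, le_rfl⟩

variable [NormedSpace ℝ X]

/-- Each Euler step of length `h` adds at most `h (‖f‖ + ‖y‖)` to the distance from `x` and
amplifies by `(1 - hω)⁻¹ ≤ e^{2hω}`. The crude factor `2` is harmless because the estimate is later
used only as `t → 0`. -/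
theorem IsMildSolution.norm_sub_initial_le {ω : ℝ} (hω : 0 ≤ ω) {A : Set (X × X)}
    (hA : IsAccretive ω A) {x y : X} (hxy : (x, y) ∈ A) {u : ℝ → X} (hu : IsMildSolution A x u)
    {t : ℝ} (ht : 0 < t) : ‖u t - x‖ ≤ Real.exp (2 * ω * t) * (t * ‖y‖) := by
  have key : ∀ᶠ ε in 𝓝[>] (0 : ℝ), ‖u t - x‖ ≤
      Real.exp (2 * ω * (t + ε)) * (2 * ε + (t + ε) * ‖y‖) + ε := by
    have e1 : ∀ᶠ ε in 𝓝[>] (0 : ℝ), ε * ω < 1 / 2 := by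
      refine eventually_nhdsWithin_of_eventually_nhds (Tendsto.eventually_lt_const
        (by norm_num : (0 : ℝ) * ω < 1 / 2) ?_)
      exact (continuous_id.mul continuous_const).tendsto' _ _ rfl
    have e2 : ∀ᶠ ε in 𝓝[>] (0 : ℝ), ε < 1 :=
      eventually_nhdsWithin_of_eventually_nhds (eventually_lt_nhds one_pos)
    filter_upwards [e1, e2, self_mem_nhdsWithin] with ε hε1 hε2 hε0
    -- The horizon `t + 1`, together with `ε < 1`, ensures that the mesh reaches beyond `t`.
    obtain ⟨N, τ, z, f, h0, hN, hNT, hstep, hf, hzA, hz0, hclose⟩ :=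
      hu.2.2 (t + 1) (by linarith) ε hε0
    have hmono := fun i hi => (hstep i hi).1
    have claim : ∀ i ≤ N, ‖z i - x‖ ≤ Real.exp (2 * ω * τ i) * (‖z 0 - x‖ +
        ∑ l ∈ Finset.range i, (τ (l + 1) - τ l) * ‖f (l + 1)‖ + τ i * ‖y‖) := by
      intro i
      induction i with
      | zero => intro _; simp [h0]
      | succ i ih =>
        intro hi
        have hτ0 : 0 ≤ τ i := h0 ▸ mesh_mono hmono (Nat.zero_le i) (by omega)
        obtain ⟨hh0, hhε⟩ := hstep i hi
        have hh : 0 < τ (i + 1) - τ i := by linarith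
        have hhω : (τ (i + 1) - τ i) * ω ≤ 1 / 2 :=
          (mul_le_mul_of_nonneg_right hhε hω).trans hε1.le
        have s1 := hA.step hxy hh (by linarith) (hzA i hi)
        have s2 := ih (by omega)
        have s3 := one_le_one_sub_mul_exp (mul_nonneg hh.le hω) hhω
        rw [Finset.sum_range_succ]
        set h := τ (i + 1) - τ i with hdef
        set F := ∑ l ∈ Finset.range i, (τ (l + 1) - τ l) * ‖f (l + 1)‖
        have hF : 0 ≤ F := Finset.sum_nonneg fun l hl => mul_nonneg
          (sub_nonneg.2 (hmono l (by have := Finset.mem_range.1 hl; omega)).le) (norm_nonneg _)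
        have hexp1 : 1 ≤ Real.exp (2 * ω * τ i) := Real.one_le_exp (by positivity)
        have s4 : (1 - h * ω) * ‖z (i + 1) - x‖ ≤ Real.exp (2 * ω * τ i) *
            (‖z 0 - x‖ + (F + h * ‖f (i + 1)‖) + τ (i + 1) * ‖y‖) := by
          have : h * ‖f (i + 1)‖ + h * ‖y‖ ≤
              Real.exp (2 * ω * τ i) * (h * ‖f (i + 1)‖ + h * ‖y‖) :=
            le_mul_of_one_le_left (by positivity) hexp1
          have e : τ (i + 1) = τ i + h := by rw [hdef]; ring
          rw [e]
          linarith
        have hexp : Real.exp (2 * ω * τ (i + 1)) =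
            Real.exp (2 * (h * ω)) * Real.exp (2 * ω * τ i) := by
          rw [← Real.exp_add, hdef]; ring_nf
        rw [hexp, mul_assoc]
        refine le_trans ?_ (mul_le_mul_of_nonneg_left s4 (Real.exp_pos _).le)
        rw [← mul_assoc, mul_comm (Real.exp _)]
        exact le_mul_of_one_le_left (norm_nonneg _) s3
    obtain ⟨i, hi, hti⟩ := exists_mem_Ioc_mesh (N := N) (t := τ) (s := t) (by rw [h0]; exact ht)
      (by linarith)
    have c1 := claim (i + 1) hi
    have c2 := hclose i hi t hti
    have c3 : ∑ l ∈ Finset.range (i + 1), (τ (l + 1) - τ l) * ‖f (l + 1)‖ ≤ ε := by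
      refine le_trans (Finset.sum_le_sum_of_subset_of_nonneg
        (Finset.range_subset_range.2 hi) fun l hl _ => ?_) hf
      exact mul_nonneg (sub_nonneg.2 (hmono l (Finset.mem_range.1 hl)).le) (norm_nonneg _)
    have c4 : τ (i + 1) ≤ t + ε := by linarith [(hstep i hi).2, hti.1]
    have c5 : Real.exp (2 * ω * τ (i + 1)) ≤ Real.exp (2 * ω * (t + ε)) :=
      Real.exp_le_exp.2 (mul_le_mul_of_nonneg_left c4 (by positivity))
    have c6 : ‖z 0 - x‖ + ∑ l ∈ Finset.range (i + 1), (τ (l + 1) - τ l) * ‖f (l + 1)‖ +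
        τ (i + 1) * ‖y‖ ≤ 2 * ε + (t + ε) * ‖y‖ := by
      have := mul_le_mul_of_nonneg_right c4 (norm_nonneg y)
      linarith
    have hε : 0 < ε := hε0
    have c7 := c1.trans ((mul_le_mul_of_nonneg_left c6 (Real.exp_pos _).le).trans
      (mul_le_mul_of_nonneg_right c5 (by positivity)))
    have c8 := norm_add_le (u t - z (i + 1)) (z (i + 1) - x)
    rw [sub_add_sub_cancel] at c8
    linarith
  refine ge_of_tendsto (Tendsto.mono_left ?_ nhdsWithin_le_nhds) key
  have : Continuous fun ε : ℝ =>
      Real.exp (2 * ω * (t + ε)) * (2 * ε + (t + ε) * ‖y‖) + ε := by fun_prop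
  exact this.tendsto' _ _ (by simp)

/-- Discard the part of a finer mesh before its first node at or after `r`. That node misses `r` by
at most `e`, and uniform continuity of `u` absorbs the time shift. -/
theorem IsMildSolution.shift {A : Set (X × X)} {x : X} {u : ℝ → X} (hu : IsMildSolution A x u)
    {r : ℝ} (hr : 0 < r) : IsMildSolution A (u r) (fun t => u (r + t)) := by
  refine ⟨?_, by simp, fun T hT ε hε => ?_⟩
  · refine hu.1.comp (by fun_prop) fun t ht => ?_
    simp only [mem_Ici] at ht ⊢
    linarith
  · have huc : UniformContinuousOn u (Icc 0 (T + r + 1)) :=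
      isCompact_Icc.uniformContinuousOn_of_continuous (hu.1.mono Icc_subset_Ici_self)
    obtain ⟨δ, hδ, hδu⟩ := Metric.uniformContinuousOn_iff.1 huc (ε / 2) (by positivity)
    obtain ⟨e, he, heε, heδ, heT⟩ : ∃ e > 0, e ≤ ε / 2 ∧ e < δ ∧ e < min T 1 := by
      have : 0 < min (ε / 2) (min δ (min T 1)) := by positivity
      refine ⟨min (ε / 2) (min δ (min T 1)) / 2, by positivity, ?_, ?_, ?_⟩
      · linarith [min_le_left (ε / 2) (min δ (min T 1))]
      · linarith [min_le_right (ε / 2) (min δ (min T 1)), min_le_left δ (min T 1)]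
      · linarith [min_le_right (ε / 2) (min δ (min T 1)), min_le_right δ (min T 1)]
    obtain ⟨N, t, z, f, h0, hN, hNT, hstep, hf, hzA, hz0, hclose⟩ :=
      hu.2.2 (T + r) (by linarith) e he
    have heT' : e < T := heT.trans_le (min_le_left _ _)
    have he1 : e < 1 := heT.trans_le (min_le_right _ _)
    obtain ⟨i, hi, hri⟩ := exists_mem_Ioc_mesh (N := N) (t := t) (s := r) (by rw [h0]; exact hr)
      (by linarith)
    have hti : t (i + 1) ≤ r + e := by linarith [(hstep i hi).2, hri.1]
    have hmono := fun i hi => (hstep i hi).1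
    refine ⟨N - (i + 1), fun j => t (i + 1 + j) - t (i + 1), fun j => z (i + 1 + j),
      fun j => f (i + 1 + j), by simp, ?_, ?_, fun j hj => ?_, ?_, fun j hj => ?_, ?_,
      fun j hj s hs => ?_⟩
    · beta_reduce
      rw [Nat.add_sub_of_le (Nat.succ_le_of_lt hi)]
      linarith
    · beta_reduce
      rw [Nat.add_sub_of_le (Nat.succ_le_of_lt hi)]
      linarith [hri.2]
    · have := hstep (i + 1 + j) (by omega)
      beta_reduce
      rw [← add_assoc]
      exact ⟨by linarith [this.1], by linarith [this.2]⟩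
    · have hsum : ∑ l ∈ Finset.range (N - (i + 1)),
          (t (i + 1 + l + 1) - t (i + 1 + l)) * ‖f (i + 1 + l + 1)‖ ≤ e := by
        refine le_trans ?_ hf
        rw [← Finset.sum_range_add_sum_Ico _ hi, Finset.sum_Ico_eq_sum_range]
        refine le_add_of_nonneg_left (Finset.sum_nonneg fun l hl => ?_)
        exact mul_nonneg (sub_nonneg.2
          (hmono l (by have := Finset.mem_range.1 hl; omega)).le) (norm_nonneg _)
      refine le_trans (le_of_eq (Finset.sum_congr rfl fun l _ => ?_)) (hsum.trans (by linarith))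
      beta_reduce
      rw [← add_assoc]
      ring
    · have := hzA (i + 1 + j) (by omega)
      simp only [← add_assoc] at this ⊢
      rwa [sub_sub_sub_cancel_right]
    · have := hclose i hi r hri
      rw [norm_sub_rev]
      simpa using this.trans (by linarith)
    · have hs' : s + t (i + 1) ∈ Ioc (t (i + 1 + j)) (t (i + 1 + j + 1)) := by
        beta_reduce at hs
        rw [← add_assoc] at hs
        exact ⟨by linarith [hs.1], by linarith [hs.2]⟩
      have h1 := hclose (i + 1 + j) (by omega) _ hs'
      have h2 : t (i + 1) ≤ t (i + 1 + j) := mesh_mono hmono (by omega) (by omega)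
      have h3 : t (i + 1 + j + 1) ≤ t N := mesh_mono hmono (by omega) le_rfl
      have hs0 : 0 < s := by linarith [hs'.1]
      have hsT : s + t (i + 1) ≤ T + r := by linarith [hs'.2]
      have h4 := hδu (r + s) ⟨by linarith, by linarith [hri.2]⟩ (s + t (i + 1))
        ⟨by linarith [hri.2], by linarith⟩ (by
          rw [Real.dist_eq, abs_lt]
          constructor <;> linarith [hri.2])
      rw [dist_eq_norm] at h4
      have h5 := norm_add_le (u (r + s) - u (s + t (i + 1))) (u (s + t (i + 1)) - z (i + 1 + j + 1))
      rw [sub_add_sub_cancel] at h5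
      simp only [← add_assoc]
      linarith

end Mild

/-! ### Lipschitz dependence on initial data and the semigroup law -/

section Lipschitz

variable {X : Type*} [NormedAddCommGroup X] [NormedSpace ℝ X]

/-- Mild solutions depend Lipschitz continuously on the initial value. -/
theorem IsMildSolution.norm_sub_le {ω : ℝ} (hω : 0 ≤ ω) {A : Set (X × X)}
    (hA : IsAccretive ω A) {x y : X} {u v : ℝ → X} (hu : IsMildSolution A x u)
    (hv : IsMildSolution A y v) {t : ℝ} (ht : 0 < t) :
    ‖u t - v t‖ ≤ Real.exp (2 * ω * (t + 1)) * ‖x - y‖ := by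
  set T := t + 1 with hT
  have hT0 : 0 < T := by linarith
  suffices h : ∀ η > 0, ‖u t - v t‖ ≤ Real.exp (2 * ω * T) * (‖x - y‖ + η) by
    have h' : ∀ᶠ η in 𝓝[>] (0 : ℝ), ‖u t - v t‖ ≤ Real.exp (2 * ω * T) * (‖x - y‖ + η) :=
      eventually_mem_nhdsWithin.mono h
    refine ge_of_tendsto (Tendsto.mono_left ?_ nhdsWithin_le_nhds) h'
    have : Continuous fun η : ℝ => Real.exp (2 * ω * T) * (‖x - y‖ + η) := by fun_prop
    exact this.tendsto' _ _ (by simp)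
  intro η hη
  obtain ⟨L₁, hL₁, hu1⟩ := exists_quadratic_modulus hu.1 T hη
  obtain ⟨L₂, hL₂, hv1⟩ := exists_quadratic_modulus hv.1 T hη
  obtain ⟨L, hL, hu2, hv2⟩ : ∃ L : ℝ, 0 ≤ L ∧ (∀ s ∈ Icc 0 T, ‖u s - x‖ ≤ η + L * s ^ 2) ∧
      ∀ s ∈ Icc 0 T, ‖v s - y‖ ≤ η + L * s ^ 2 := by
    refine ⟨L₁ + L₂, by positivity, fun s hs => ?_, fun s hs => ?_⟩
    · have := hu1 s hs
      rw [hu.2.1] at this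
      nlinarith [sq_nonneg s]
    · have := hv1 s hs
      rw [hv.2.1] at this
      nlinarith [sq_nonneg s]
  have key : ∀ᶠ ε in 𝓝[>] (0 : ℝ), ‖u t - v t‖ ≤ Real.exp (2 * ω * T) *
      (‖x - y‖ + η + 2 * ε + L * (ε * (1 + 2 * ω * T)) ^ 2 + L * (2 * ε) * (3 * T) + 2 * ε + ε)
      + 2 * ε := by
    have e1 : ∀ᶠ ε in 𝓝[>] (0 : ℝ), ε * ω < 1 / 2 := by
      refine eventually_nhdsWithin_of_eventually_nhds (Tendsto.eventually_lt_const
        (by norm_num : (0 : ℝ) * ω < 1 / 2) ?_)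
      exact (continuous_id.mul continuous_const).tendsto' _ _ rfl
    have e2 : ∀ᶠ ε in 𝓝[>] (0 : ℝ), ε < 1 :=
      eventually_nhdsWithin_of_eventually_nhds (eventually_lt_nhds one_pos)
    filter_upwards [e1, e2, self_mem_nhdsWithin] with ε hε1 hε2 hε0
    have hε : 0 < ε := hε0
    obtain ⟨N, τ, z, f, h0, hN, hNT, hstep, hf, hzA, hz0, hclose⟩ := hu.2.2 T hT0 ε hε
    obtain ⟨N', σ, w, g, h0', hN', hNT', hstep', hg, hwA, hw0, hclose'⟩ := hv.2.2 T hT0 ε hε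
    have hmono := fun i hi => (hstep i hi).1
    have hmono' := fun i hi => (hstep' i hi).1
    have hτ : ∀ i ≤ N, τ i ∈ Icc 0 T := fun i hi =>
      ⟨h0 ▸ mesh_mono hmono (Nat.zero_le i) hi, (mesh_mono hmono hi le_rfl).trans hNT⟩
    have hσ : ∀ i ≤ N', σ i ∈ Icc 0 T := fun i hi =>
      ⟨h0' ▸ mesh_mono hmono' (Nat.zero_le i) hi, (mesh_mono hmono' hi le_rfl).trans hNT'⟩
    -- Weighting the distances by the products `π i` of the `c l`, and replacing the first scheme's
    -- steps by `h / c`, turns the recursion for type `ω` into the one for `ω = 0`. The rescaled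
    -- times differ from `τ i` only by `O(ε)`.
    set c : ℕ → ℝ := fun i => 1 - (τ (i + 1) - τ i) * ω with hc
    have hh : ∀ i < N, 0 < τ (i + 1) - τ i := fun i hi => sub_pos.2 (hmono i hi)
    have hhω : ∀ i < N, 0 ≤ (τ (i + 1) - τ i) * ω ∧ (τ (i + 1) - τ i) * ω ≤ 1 / 2 :=
      fun i hi => ⟨mul_nonneg (hh i hi).le hω,
        (mul_le_mul_of_nonneg_right (hstep i hi).2 hω).trans hε1.le⟩
    have hc1 : ∀ i < N, 1 / 2 ≤ c i ∧ c i ≤ 1 := fun i hi =>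
      ⟨by simp only [hc]; linarith [(hhω i hi).2], by simp only [hc]; linarith [(hhω i hi).1]⟩
    have hc0 : ∀ i < N, 0 < c i := fun i hi => by linarith [(hc1 i hi).1]
    set π : ℕ → ℝ := fun i => ∏ l ∈ Finset.range i, c l with hπ
    have hπ0 : ∀ i ≤ N, 0 ≤ π i := fun i hi => Finset.prod_nonneg fun l hl =>
      (hc0 l ((Finset.mem_range.1 hl).trans_le hi)).le
    have hπ1 : ∀ i ≤ N, π i ≤ 1 := fun i hi => Finset.prod_le_one
      (fun l hl => (hc0 l ((Finset.mem_range.1 hl).trans_le hi)).le)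
      fun l hl => (hc1 l ((Finset.mem_range.1 hl).trans_le hi)).2
    have hπe : ∀ i ≤ N, 1 ≤ Real.exp (2 * ω * τ i) * π i := by
      intro i
      induction i with
      | zero => intro _; simp [hπ, h0]
      | succ i ih =>
        intro hi
        have s1 := ih (by omega)
        have s2 := one_le_one_sub_mul_exp (hhω i hi).1 (hhω i hi).2
        have hexp : Real.exp (2 * ω * τ (i + 1)) =
            Real.exp (2 * ((τ (i + 1) - τ i) * ω)) * Real.exp (2 * ω * τ i) := by
          rw [← Real.exp_add]; ring_nf
        have hs : π (i + 1) = π i * c i := Finset.prod_range_succ _ _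
        rw [hexp, hs]
        calc (1 : ℝ) ≤ (c i * Real.exp (2 * ((τ (i + 1) - τ i) * ω))) *
              (Real.exp (2 * ω * τ i) * π i) := one_le_mul_of_one_le_of_one_le s2 s1
          _ = _ := by ring
    have hdiv : ∀ i < N, τ (i + 1) - τ i ≤ (τ (i + 1) - τ i) / c i ∧
        (τ (i + 1) - τ i) / c i ≤ (τ (i + 1) - τ i) * (1 + 2 * ε * ω) ∧
        (τ (i + 1) - τ i) / c i ≤ 2 * (τ (i + 1) - τ i) := by
      intro i hi
      have hc0i := hc0 i hi
      have hhi := hh i hi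
      have q2 : (τ (i + 1) - τ i) / c i ≤ 2 * (τ (i + 1) - τ i) := by
        rw [div_le_iff₀ hc0i]
        nlinarith [(hc1 i hi).1]
      refine ⟨?_, ?_, q2⟩
      · rw [le_div_iff₀ hc0i]
        exact mul_le_of_le_one_right hhi.le (hc1 i hi).2
      · have e : (τ (i + 1) - τ i) / c i =
            (τ (i + 1) - τ i) + (τ (i + 1) - τ i) / c i * ((τ (i + 1) - τ i) * ω) := by
          have : (τ (i + 1) - τ i) * ω = 1 - c i := by simp only [hc]; ring
          rw [this]
          field_simp
          ring
        have q3 : (τ (i + 1) - τ i) / c i * ((τ (i + 1) - τ i) * ω) ≤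
            2 * (τ (i + 1) - τ i) * (ε * ω) :=
          mul_le_mul q2 (mul_le_mul_of_nonneg_right (hstep i hi).2 hω) (hhω i hi).1
            (by positivity)
        rw [e]
        linarith
    have hsum1 : ∀ i ≤ N, τ i ≤ ∑ l ∈ Finset.range i, (τ (l + 1) - τ l) / c l := fun i hi => by
      rw [← mesh_eq_sum h0]
      exact Finset.sum_le_sum fun l hl => (hdiv l ((Finset.mem_range.1 hl).trans_le hi)).1
    have hsum2 : ∀ i ≤ N, ∑ l ∈ Finset.range i, (τ (l + 1) - τ l) / c l ≤
        τ i * (1 + 2 * ε * ω) := fun i hi => by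
      rw [← mesh_eq_sum h0, Finset.sum_mul]
      exact Finset.sum_le_sum fun l hl => (hdiv l ((Finset.mem_range.1 hl).trans_le hi)).2.1
    have hsum3 : ∀ i ≤ N, ∑ l ∈ Finset.range i, (τ (l + 1) - τ l) / c l ≤ 2 * τ i :=
        fun i hi => by
      rw [← mesh_eq_sum h0, Finset.mul_sum]
      exact Finset.sum_le_sum fun l hl => (hdiv l ((Finset.mem_range.1 hl).trans_le hi)).2.2
    have comp := double_index_comparison (N := N) (N' := N')
      (h := fun i => (τ (i + 1) - τ i) / c i) (k := fun j => σ (j + 1) - σ j)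
      (p := fun i => ‖f (i + 1)‖) (q := fun j => ‖g (j + 1)‖)
      (a := fun i j => π i * ‖z i - w j‖) (D := ‖x - y‖ + η + 2 * ε) (L := L) (δ := 2 * ε) hL
      (fun i hi => ⟨div_pos (hh i hi) (hc0 i hi), by
        linarith [(hdiv i hi).2.2, (hstep i hi).2]⟩)
      (fun j hj => ⟨sub_pos.2 (hmono' j hj), by linarith [(hstep' j hj).2]⟩)
      (fun i _ => norm_nonneg _) (fun j _ => norm_nonneg _) (fun i hi j hj => ?_)
      (fun i hi => ?_) (fun j hj => ?_) (by positivity)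
    · obtain ⟨i, hi, hti⟩ := exists_mem_Ioc_mesh (N := N) (t := τ) (s := t)
        (by rw [h0]; exact ht) (by linarith)
      obtain ⟨j, hj, htj⟩ := exists_mem_Ioc_mesh (N := N') (t := σ) (s := t)
        (by rw [h0']; exact ht) (by linarith)
      have c0 := comp (i + 1) hi (j + 1) hj
      have hsumf : ∑ l ∈ Finset.range (i + 1), (τ (l + 1) - τ l) / c l * ‖f (l + 1)‖ ≤
          2 * ε := by
        refine le_trans (Finset.sum_le_sum (g := fun l =>
          2 * ((τ (l + 1) - τ l) * ‖f (l + 1)‖)) fun l hl => ?_) ?_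
        · rw [← mul_assoc]
          exact mul_le_mul_of_nonneg_right
            (hdiv l ((Finset.mem_range.1 hl).trans_le hi)).2.2 (norm_nonneg _)
        · rw [← Finset.mul_sum]
          refine mul_le_mul_of_nonneg_left (le_trans (Finset.sum_le_sum_of_subset_of_nonneg
            (Finset.range_subset_range.2 hi) fun l hl _ => ?_) hf) zero_le_two
          exact mul_nonneg (hh l (Finset.mem_range.1 hl)).le (norm_nonneg _)
      have hsumg : ∑ l ∈ Finset.range (j + 1), (σ (l + 1) - σ l) * ‖g (l + 1)‖ ≤ ε := by
        refine le_trans (Finset.sum_le_sum_of_subset_of_nonneg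
          (Finset.range_subset_range.2 hj) fun l hl _ => ?_) hg
        exact mul_nonneg (sub_nonneg.2 (hmono' l (Finset.mem_range.1 hl)).le) (norm_nonneg _)
      have d1 := hsum1 (i + 1) hi
      have d2 := hsum2 (i + 1) hi
      have d3 := hsum3 (i + 1) hi
      have d4 := hτ (i + 1) hi
      have d5 := hσ (j + 1) hj
      have d6 := (hstep i hi).2
      have d7 := (hstep' j hj).2
      simp only [mesh_eq_sum h0'] at c0
      set θ := ∑ l ∈ Finset.range (i + 1), (τ (l + 1) - τ l) / c l
      -- Both nodes lie within one mesh width after `t`; rescaling moves the first by at most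
      -- `2εωT`. Thus the quadratic term vanishes in the limit, however large `L` is.
      have hsq : (θ - σ (j + 1)) ^ 2 ≤ (ε * (1 + 2 * ω * T)) ^ 2 := by
        have hTε : τ (i + 1) * (2 * ε * ω) ≤ T * (2 * ε * ω) :=
          mul_le_mul_of_nonneg_right d4.2 (by positivity)
        have : 0 ≤ T * (2 * ε * ω) := by positivity
        refine sq_le_sq' ?_ ?_ <;> linarith [hti.1, hti.2, htj.1, htj.2]
      have g1 : L * (θ - σ (j + 1)) ^ 2 ≤ L * (ε * (1 + 2 * ω * T)) ^ 2 :=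
        mul_le_mul_of_nonneg_left hsq hL
      have g2 : L * (2 * ε) * (θ + σ (j + 1)) ≤ L * (2 * ε) * (3 * T) :=
        mul_le_mul_of_nonneg_left (by linarith [d4.2, d5.2]) (by positivity)
      have g3 : π (i + 1) * ‖z (i + 1) - w (j + 1)‖ ≤ ‖x - y‖ + η + 2 * ε +
          L * (ε * (1 + 2 * ω * T)) ^ 2 + L * (2 * ε) * (3 * T) + 2 * ε + ε := by linarith
      have g4 : ‖z (i + 1) - w (j + 1)‖ ≤ Real.exp (2 * ω * T) *
          (π (i + 1) * ‖z (i + 1) - w (j + 1)‖) := by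
        rw [← mul_assoc]
        refine le_mul_of_one_le_left (norm_nonneg _) ((hπe (i + 1) hi).trans ?_)
        exact mul_le_mul_of_nonneg_right (Real.exp_le_exp.2
          (mul_le_mul_of_nonneg_left d4.2 (by positivity))) (hπ0 _ hi)
      have g5 := g4.trans (mul_le_mul_of_nonneg_left g3 (Real.exp_pos _).le)
      have g6 := hclose i hi t hti
      have g7 := hclose' j hj t htj
      have g8 : ‖u t - v t‖ ≤ ‖u t - z (i + 1)‖ + ‖z (i + 1) - w (j + 1)‖ +
          ‖v t - w (j + 1)‖ := by
        rw [norm_sub_rev (v t)]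
        refine le_trans (le_of_eq ?_) ((norm_add_le _ _).trans
          (add_le_add (norm_add_le _ _) le_rfl))
        congr 1
        abel
      linarith
    · have s1 := hA.step_step hω (hh i hi) (sub_pos.2 (hmono' j hj))
        (by linarith [(hhω i hi).2]) (hzA i hi) (hwA j hj)
      have s2 := mul_le_mul_of_nonneg_left s1 (hπ0 i hi.le)
      have hs : π (i + 1) = π i * c i := Finset.prod_range_succ _ _
      have hci := hc0 i hi
      have hF : 0 ≤ (τ (i + 1) - τ i) * (σ (j + 1) - σ j) * (‖f (i + 1)‖ + ‖g (j + 1)‖) :=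
        mul_nonneg (mul_nonneg (hh i hi).le (sub_pos.2 (hmono' j hj)).le) (by positivity)
      have s3 : π i * ((τ (i + 1) - τ i) * (σ (j + 1) - σ j) *
          (‖f (i + 1)‖ + ‖g (j + 1)‖)) ≤
          (τ (i + 1) - τ i) / c i * (σ (j + 1) - σ j) * (‖f (i + 1)‖ + ‖g (j + 1)‖) := by
        refine (mul_le_of_le_one_left hF (hπ1 i hi.le)).trans ?_
        exact mul_le_mul_of_nonneg_right (mul_le_mul_of_nonneg_right (hdiv i hi).1
          (sub_pos.2 (hmono' j hj)).le) (by positivity)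
      have s4 : ((τ (i + 1) - τ i) / c i + (σ (j + 1) - σ j)) *
          (π (i + 1) * ‖z (i + 1) - w (j + 1)‖) =
          π i * ((τ (i + 1) - τ i + (σ (j + 1) - σ j) * c i) * ‖z (i + 1) - w (j + 1)‖) := by
        rw [hs]; field_simp
      have s5 : (τ (i + 1) - τ i) / c i * (π (i + 1) * ‖z (i + 1) - w j‖) =
          π i * ((τ (i + 1) - τ i) * ‖z (i + 1) - w j‖) := by
        rw [hs]; field_simp
      rw [s4, s5]
      simp only [hc] at s2 s3 ⊢
      linarith
    · have b1 := norm_node_sub_le h0 hu.2.1 hz0 hmono hclose hi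
      have b2 := hu2 _ (hτ i hi)
      have b3 : ‖z i - w 0‖ ≤ ‖z i - u (τ i)‖ + ‖u (τ i) - x‖ + ‖x - y‖ + ‖w 0 - y‖ := by
        rw [norm_sub_rev (w 0)]
        refine le_trans (le_of_eq ?_) ((norm_add_le _ _).trans
          (add_le_add ((norm_add_le _ _).trans (add_le_add (norm_add_le _ _) le_rfl)) le_rfl))
        congr 1
        abel
      have b4 : L * τ i ^ 2 ≤ L * (∑ l ∈ Finset.range i, (τ (l + 1) - τ l) / c l) ^ 2 :=
        mul_le_mul_of_nonneg_left (pow_le_pow_left₀ (hτ i hi).1 (hsum1 i hi) 2) hL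
      refine (mul_le_of_le_one_left (norm_nonneg _) (hπ1 i hi)).trans ?_
      linarith
    · have b1 := norm_node_sub_le h0' hv.2.1 hw0 hmono' hclose' hj
      have b2 := hv2 _ (hσ j hj)
      have b3 : ‖z 0 - w j‖ ≤ ‖z 0 - x‖ + ‖x - y‖ + ‖v (σ j) - y‖ + ‖w j - v (σ j)‖ := by
        rw [norm_sub_rev (v _), norm_sub_rev (w j)]
        refine le_trans (le_of_eq ?_) ((norm_add_le _ _).trans
          (add_le_add ((norm_add_le _ _).trans (add_le_add (norm_add_le _ _) le_rfl)) le_rfl))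
        congr 1
        abel
      rw [mesh_eq_sum h0']
      have : π 0 = 1 := Finset.prod_range_zero _
      rw [this, one_mul]
      linarith
  refine ge_of_tendsto (Tendsto.mono_left ?_ nhdsWithin_le_nhds) key
  have : Continuous fun ε : ℝ => Real.exp (2 * ω * T) *
      (‖x - y‖ + η + 2 * ε + L * (ε * (1 + 2 * ω * T)) ^ 2 + L * (2 * ε) * (3 * T) + 2 * ε + ε)
      + 2 * ε := by fun_prop
  exact this.tendsto' _ _ (by simp)

theorem IsGeneratedBy.norm_sub_le {ω : ℝ} (hω : 0 ≤ ω) {A : Set (X × X)}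
    (hA : IsAccretive ω A) {S : ℝ → X → X} (hS : IsGeneratedBy A S) {x y : X}
    (hx : x ∈ closure (dom A)) (hy : y ∈ closure (dom A)) {t : ℝ} (ht : 0 < t) :
    ‖S t x - S t y‖ ≤ Real.exp (2 * ω * (t + 1)) * ‖x - y‖ :=
  (hS x hx).norm_sub_le hω hA (hS y hy) ht

/-- The semigroup law. -/
theorem IsGeneratedBy.add {ω : ℝ} (hω : 0 ≤ ω) {A : Set (X × X)}
    (hA : IsAccretive ω A) {S : ℝ → X → X} (hS : IsGeneratedBy A S) {x : X}
    (hx : x ∈ closure (dom A)) {r t : ℝ} (hr : 0 < r) (ht : 0 < t)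
    (hrx : S r x ∈ closure (dom A)) : S (r + t) x = S t (S r x) := by
  have h := ((hS x hx).shift hr).norm_sub_le hω hA (hS _ hrx) ht
  rw [sub_self, norm_zero, mul_zero] at h
  exact sub_eq_zero.1 (norm_le_zero_iff.1 h)

end Lipschitz

/-! ### The `K`-function along orbits -/

section Orbits

variable {X : Type*} [NormedAddCommGroup X]

theorem setNorm_eq_top {A : Set (X × X)} {x : X} (hx : x ∉ dom A) : setNorm A x = ∞ := by
  simp only [setNorm, iInf_eq_top]
  exact fun f hf => absurd ⟨f, hf⟩ hx

theorem opK_le {A : Set (X × X)} (x v : X) (t : ℝ) :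
    opK A x t ≤ ‖x - v‖ₑ + ENNReal.ofReal t * setNorm A v := iInf_le _ v

theorem opK_le_setNorm {A : Set (X × X)} (x : X) (t : ℝ) :
    opK A x t ≤ ENNReal.ofReal t * setNorm A x := by
  simpa using opK_le (A := A) x x t

theorem monotone_opK (A : Set (X × X)) (x : X) : Monotone (opK A x) := fun s t hst =>
  iInf_mono fun v => by gcongr

theorem opK_lt_top {A : Set (X × X)} (hA : A.Nonempty) (x : X) (t : ℝ) : opK A x t < ∞ := by
  obtain ⟨p, hp⟩ := hA
  have h : setNorm A p.1 ≤ ‖p.2‖ₑ := iInf₂_le p.2 hp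
  refine (opK_le x p.1 t).trans_lt (ENNReal.add_lt_top.2 ⟨enorm_lt_top, ?_⟩)
  exact ENNReal.mul_lt_top ENNReal.ofReal_lt_top (h.trans_lt enorm_lt_top)

/-- Only `v` in the domain compete in the infimum, the other terms being infinite. -/
theorem infEDist_dom_le_opK (A : Set (X × X)) (x : X) {t : ℝ} (ht : 0 < t) :
    Metric.infEDist x (dom A) ≤ opK A x t := by
  refine le_iInf fun v => ?_
  by_cases hv : v ∈ dom A
  · refine le_trans ?_ le_self_add
    beta_reduce
    rw [← edist_eq_enorm_sub]
    exact Metric.infEDist_le_edist_of_mem hv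
  · rw [setNorm_eq_top hv, ENNReal.mul_top (by simpa using ht), add_top]
    exact le_top

variable [NormedSpace ℝ X]

theorem IsMildSolution.enorm_sub_initial_le {ω : ℝ} (hω : 0 ≤ ω) {A : Set (X × X)}
    (hA : IsAccretive ω A) {x : X} {u : ℝ → X} (hu : IsMildSolution A x u) {t : ℝ} (ht : 0 < t) :
    ‖u t - x‖ₑ ≤ ENNReal.ofReal (Real.exp (2 * ω * t) * t) * setNorm A x := by
  have hpos : 0 < Real.exp (2 * ω * t) * t := by positivity
  have h0 : ENNReal.ofReal (Real.exp (2 * ω * t) * t) ≠ 0 := by simpa using hpos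
  rw [setNorm, ENNReal.mul_iInf_of_ne h0 ENNReal.ofReal_ne_top]
  refine le_iInf fun f => ?_
  rw [ENNReal.mul_iInf_of_ne h0 ENNReal.ofReal_ne_top]
  refine le_iInf fun hf => ?_
  rw [← ofReal_norm, ← ofReal_norm, ← ENNReal.ofReal_mul hpos.le, mul_assoc]
  exact ENNReal.ofReal_le_ofReal (hu.norm_sub_initial_le hω hA hf ht)

/-- The displacement of a mild solution is controlled by the integral of the set norms along it. -/
theorem IsMildSolution.enorm_sub_initial_le_lintegral [CompleteSpace X] {ω : ℝ} (hω : 0 ≤ ω)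
    {A : Set (X × X)} (hA : IsAccretive ω A) {x : X} {u : ℝ → X} (hu : IsMildSolution A x u)
    {t : ℝ} (ht : 0 < t) : ‖u t - x‖ₑ ≤ ∫⁻ s in Ioc 0 t, setNorm A (u s) := by
  set I := ∫⁻ s in Ioc 0 t, setNorm A (u s) with hI
  by_cases hItop : I = ∞
  · rw [hItop]; exact le_top
  set v : ℝ → X := fun s => u (max s 0) with hv
  have hvc : Continuous v := hu.1.comp_continuous (by fun_prop) fun s => le_max_right s 0
  have hvu : ∀ s, 0 ≤ s → v s = u s := fun s hs => by simp only [hv, max_eq_left hs]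
  have hint : ∀ a b, IntervalIntegrable v volume a b := fun a b => hvc.intervalIntegrable a b
  have hderiv : ∀ s, HasDerivAt (fun r => ∫ σ in (0 : ℝ)..r, v σ) (v s) s := fun s =>
    intervalIntegral.integral_hasDerivAt_right (hint _ _)
      hvc.stronglyMeasurable.stronglyMeasurableAtFilter hvc.continuousAt
  -- The difference quotients of the primitive of `v` at `t` and at `0` differ by the mean `h⁻¹ ∫₀ᵗ
  -- (v(s+h) - v(s)) ds`, which therefore tends to `u t - x`.
  have hlim := ((hderiv t).tendsto_slope_zero_right.sub
    (hderiv 0).tendsto_slope_zero_right).enorm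
  rw [hvu t ht.le, hvu 0 le_rfl, hu.2.1] at hlim
  have hlim2 : Tendsto (fun h : ℝ => ENNReal.ofReal (Real.exp (2 * ω * h)) * I) (𝓝[>] 0)
      (𝓝 (1 * I)) := by
    refine ENNReal.Tendsto.mul_const (Tendsto.mono_left ?_ nhdsWithin_le_nhds)
      (Or.inr hItop)
    have : Continuous fun h : ℝ => ENNReal.ofReal (Real.exp (2 * ω * h)) :=
      ENNReal.continuous_ofReal.comp (by fun_prop)
    exact this.tendsto' _ _ (by simp)
  rw [one_mul] at hlim2
  refine le_of_tendsto_of_tendsto hlim hlim2 ?_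
  filter_upwards [self_mem_nhdsWithin] with h hh
  have hh0 : 0 < h := hh
  have e1 : (∫ σ in (0 : ℝ)..(t + h), v σ) - (∫ σ in (0 : ℝ)..t, v σ) -
      ((∫ σ in (0 : ℝ)..(0 + h), v σ) - ∫ σ in (0 : ℝ)..0, v σ) =
      ∫ s in (0 : ℝ)..t, (v (s + h) - v s) := by
    rw [intervalIntegral.integral_sub (by exact (hvc.comp (by fun_prop)).intervalIntegrable _ _)
      (hint _ _), intervalIntegral.integral_comp_add_right, intervalIntegral.integral_same,
      ← intervalIntegral.integral_add_adjacent_intervals (hint 0 (0 + h)) (hint (0 + h) (t + h))]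
    abel
  rw [← smul_sub, e1, enorm_smul, intervalIntegral.integral_of_le ht.le]
  have e2 : ∫⁻ s in Ioc 0 t, ‖v (s + h) - v s‖ₑ ≤
      ENNReal.ofReal (Real.exp (2 * ω * h) * h) * I := by
    rw [hI, ← lintegral_const_mul' _ _ ENNReal.ofReal_ne_top]
    refine setLIntegral_mono' measurableSet_Ioc fun s hs => ?_
    rw [hvu s hs.1.le, hvu (s + h) (by linarith [hs.1])]
    exact (hu.shift hs.1).enorm_sub_initial_le hω hA hh0
  refine (mul_le_mul_right ((enorm_integral_le_lintegral_enorm _).trans e2) _).trans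
    (le_of_eq ?_)
  rw [← mul_assoc]
  congr 1
  rw [← ofReal_norm, ← ENNReal.ofReal_mul (norm_nonneg _),
    Real.norm_of_nonneg (by positivity)]
  congr 1
  field_simp

/-- If `v` competes for `x`, then `S r v` competes for `S r x`: the first term is controlled by
Lipschitz dependence, the second by `|A S(r)v| ≤ C K(v,r)/r ≤ C |Av|`. -/
theorem opK_orbit_le_mul {ω C τ₀ : ℝ} (hω : 0 ≤ ω) {A : Set (X × X)}
    (hA : IsAccretive ω A) {S : ℝ → X → X} (hS : IsGeneratedBy A S)
    (hR : IsRegularizingWith A S C τ₀) {Γ : ℝ} (hΓ : Real.exp (2 * ω * (τ₀ + 1)) ≤ Γ)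
    (hCΓ : C ≤ Γ) {x : X} (hx : x ∈ closure (dom A)) {r s : ℝ} (hr : 0 < r) (hrs : r ≤ s)
    (hs : s < τ₀) : opK A (S r x) s ≤ ENNReal.ofReal Γ * opK A x s := by
  have hΓ0 : 0 < Γ := (Real.exp_pos _).trans_le hΓ
  have h0 : ENNReal.ofReal Γ ≠ 0 := by simpa using hΓ0
  rw [opK, opK, kFun, kFun, ENNReal.mul_iInf_of_ne h0 ENNReal.ofReal_ne_top]
  refine le_iInf fun v => ?_
  by_cases hv : v ∈ dom A
  · refine (iInf_le _ (S r v)).trans ?_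
    rw [mul_add]
    refine add_le_add ?_ ?_
    · rw [← ofReal_norm, ← ofReal_norm, ← ENNReal.ofReal_mul hΓ0.le]
      refine ENNReal.ofReal_le_ofReal ((hS.norm_sub_le hω hA hx (subset_closure hv) hr).trans ?_)
      refine mul_le_mul_of_nonneg_right (le_trans (Real.exp_le_exp.2 ?_) hΓ) (norm_nonneg _)
      exact mul_le_mul_of_nonneg_left (by linarith) (by positivity)
    · rw [mul_left_comm]
      refine mul_le_mul_right ((hR.2 r ⟨hr, hrs.trans_lt hs⟩ v (subset_closure hv)).trans ?_) _
      exact mul_le_mul' (ENNReal.ofReal_le_ofReal hCΓ)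
        (ENNReal.div_le_of_le_mul' (opK_le_setNorm v r))
  · rw [setNorm_eq_top hv, ENNReal.mul_top (by simpa using hr.trans_le hrs), add_top,
      ENNReal.mul_top h0]
    exact le_top

/-- The semigroup law splits the time into at most `n` pieces no longer than `s`, each costing a
factor `Γ`. -/
theorem opK_orbit_le_pow_mul {ω C τ₀ : ℝ} (hω : 0 ≤ ω) {A : Set (X × X)}
    (hA : IsAccretive ω A) {S : ℝ → X → X} (hS : IsGeneratedBy A S)
    (hR : IsRegularizingWith A S C τ₀) {Γ : ℝ} (hΓ : Real.exp (2 * ω * (τ₀ + 1)) ≤ Γ)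
    (hCΓ : C ≤ Γ) (hΓ1 : 1 ≤ Γ) {s : ℝ} (hs0 : 0 < s) (hs : s < τ₀) (n : ℕ) :
    ∀ x ∈ closure (dom A), ∀ t : ℝ, 0 < t → t ≤ n * s →
      opK A (S t x) s ≤ ENNReal.ofReal (Γ ^ n) * opK A x s := by
  have hΓ0 : 0 ≤ Γ := zero_le_one.trans hΓ1
  induction n with
  | zero => intro x _ t ht htn; simp at htn; linarith
  | succ n ih =>
    intro x hx t ht htn
    push_cast at htn
    by_cases hts : t ≤ s
    · refine (opK_orbit_le_mul hω hA hS hR hΓ hCΓ hx ht hts hs).trans (mul_le_mul_left ?_ _)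
      exact ENNReal.ofReal_le_ofReal (le_self_pow₀ hΓ1 n.succ_ne_zero)
    · have hts' : 0 < t - s := by linarith
      have hd : S (t - s) x ∈ closure (dom A) := subset_closure (hR.1 _ hts' x hx)
      have e : S t x = S s (S (t - s) x) := by
        rw [← hS.add hω hA hx hts' hs0 hd, sub_add_cancel]
      rw [e, pow_succ', ENNReal.ofReal_mul hΓ0, mul_assoc]
      refine (opK_orbit_le_mul hω hA hS hR hΓ hCΓ hd hs0 le_rfl hs).trans
        (mul_le_mul_right (ih x hx _ hts' (by linarith)) _)

/-- The regularizing estimate extends from `(0, τ₀)` to every bounded time interval. -/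
theorem exists_setNorm_orbit_le (ω C τ₀ τ : ℝ) (hC : 0 ≤ C) (hτ₀ : 0 < τ₀) (hτ : 0 < τ) :
    ∃ M : ℝ, 0 < M ∧ ∀ (X : Type*) [NormedAddCommGroup X] [NormedSpace ℝ X]
      (A : Set (X × X)) (S : ℝ → X → X), IsAccretive ω A → IsGeneratedBy A S →
      IsRegularizingWith A S C τ₀ → ∀ x ∈ closure (dom A), ∀ t ∈ Ioo 0 τ,
        setNorm A (S t x) ≤ ENNReal.ofReal M * (opK A x t / ENNReal.ofReal t) := by
  set Γ := max (Real.exp (2 * max ω 0 * (τ₀ + 1))) (max C 1) with hΓ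
  have hΓ1 : 1 ≤ Γ := (le_max_right _ _).trans (le_max_right _ _)
  have hΓ0 : 0 < Γ := by linarith
  set n := ⌈τ / (τ₀ / 2)⌉₊ with hn
  -- The first summand serves `t ≥ τ₀`: `Γ ^ n` carries `K` along the orbit up to `t - τ₀/2`, and `τ
  -- / (τ₀/2)` trades `1/(τ₀/2)` for `1/t`. The summand `C` serves `t < τ₀`, and `1` ensures
  -- positivity.
  refine ⟨C * Γ ^ n * (τ / (τ₀ / 2)) + C + 1, by positivity,
    fun X _ _ A S hA hS hR x hx t ht => ?_⟩
  have hA' : IsAccretive (max ω 0) A := hA.mono (le_max_left _ _)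
  have ht0 : 0 < t := ht.1
  by_cases htτ : t < τ₀
  · refine (hR.2 t ⟨ht0, htτ⟩ x hx).trans (mul_le_mul_left (ENNReal.ofReal_le_ofReal ?_) _)
    have : 0 ≤ C * Γ ^ n * (τ / (τ₀ / 2)) := by positivity
    linarith
  · have hs0 : 0 < τ₀ / 2 := by positivity
    have hs : τ₀ / 2 < τ₀ := by linarith
    have hts : 0 < t - τ₀ / 2 := by linarith
    have hd : S (t - τ₀ / 2) x ∈ closure (dom A) := subset_closure (hR.1 _ hts x hx)
    have e : S t x = S (τ₀ / 2) (S (t - τ₀ / 2) x) := by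
      rw [← hS.add (le_max_right _ _) hA' hx hts hs0 hd, sub_add_cancel]
    have hle : t - τ₀ / 2 ≤ n * (τ₀ / 2) := by
      rw [← div_le_iff₀ hs0]
      refine le_trans ?_ (Nat.le_ceil _)
      exact div_le_div_of_nonneg_right (by linarith [ht.2]) hs0.le
    have h1 := opK_orbit_le_pow_mul (le_max_right ω 0) hA' hS hR (le_max_left _ _)
      ((le_max_left C 1).trans (le_max_right _ _)) hΓ1 hs0 hs n x hx _ hts hle
    have h2 : opK A x (τ₀ / 2) ≤ opK A x t := monotone_opK A x (by linarith)
    rw [e]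
    refine (hR.2 _ ⟨hs0, hs⟩ _ hd).trans ?_
    have h3 : (ENNReal.ofReal (τ₀ / 2))⁻¹ ≤
        ENNReal.ofReal (τ / (τ₀ / 2)) * (ENNReal.ofReal t)⁻¹ := by
      rw [← ENNReal.ofReal_inv_of_pos hs0, ← ENNReal.ofReal_inv_of_pos ht0,
        ← ENNReal.ofReal_mul (by positivity)]
      refine ENNReal.ofReal_le_ofReal ?_
      rw [div_mul_eq_mul_div, ← div_eq_mul_inv, inv_eq_one_div]
      exact div_le_div_of_nonneg_right ((one_le_div ht0).2 ht.2.le) hs0.le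
    calc ENNReal.ofReal C * (opK A (S (t - τ₀ / 2) x) (τ₀ / 2) / ENNReal.ofReal (τ₀ / 2))
        ≤ ENNReal.ofReal C * ((ENNReal.ofReal (Γ ^ n) * opK A x t) *
          (ENNReal.ofReal (τ / (τ₀ / 2)) * (ENNReal.ofReal t)⁻¹)) := by
          rw [div_eq_mul_inv]
          gcongr
          exact h1.trans (by gcongr)
      _ = ENNReal.ofReal (C * Γ ^ n * (τ / (τ₀ / 2))) * (opK A x t / ENNReal.ofReal t) := by
          rw [ENNReal.ofReal_mul (by positivity), ENNReal.ofReal_mul hC,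
            div_eq_mul_inv (opK A x t)]
          ring
      _ ≤ _ := mul_le_mul_left (ENNReal.ofReal_le_ofReal (by linarith)) _

end Orbits

/-! ### Extended-valued functions in `E` and the Hardy operator -/

namespace BanachFunctionSpace

variable {E : BanachFunctionSpace}

theorem Represents.unique {g g' : E.carrier} {F : ℝ → ℝ≥0∞} (hg : E.Represents g F)
    (hg' : E.Represents g' F) : g = g' := by
  refine Subtype.ext (AEEqFun.ext ?_)
  filter_upwards [hg, hg'] with t ht ht'
  exact (ENNReal.ofReal_eq_ofReal_iff ht.1 ht'.1).1 (ht.2.symm.trans ht'.2)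

theorem Represents.eNorm_eq {g : E.carrier} {F : ℝ → ℝ≥0∞} (hg : E.Represents g F) :
    E.eNorm F = ENNReal.ofReal (E.norm g) := by
  refine le_antisymm (iInf₂_le g hg) (le_iInf₂ fun g' hg' => ?_)
  rw [hg.unique hg']

theorem mem_of_eNorm_lt_top {F : ℝ → ℝ≥0∞} (hF : E.eNorm F < ∞) : E.Mem F := by
  obtain ⟨g, hg⟩ := iInf_lt_iff.1 hF
  obtain ⟨hg, _⟩ := iInf_lt_iff.1 hg
  exact ⟨g, hg⟩

theorem Mem.eNorm_lt_top {F : ℝ → ℝ≥0∞} (hF : E.Mem F) : E.eNorm F < ∞ := by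
  obtain ⟨g, hg⟩ := hF
  rw [hg.eNorm_eq]
  exact ENNReal.ofReal_lt_top

theorem exists_represents_of_le {F : ℝ → ℝ≥0∞} (hF : AEMeasurable F halfLine) (g : E.carrier)
    (hFg : ∀ᵐ t ∂halfLine, F t ≤ ENNReal.ofReal ((g : ℝ →ₘ[halfLine] ℝ) t)) :
    ∃ f : E.carrier, E.Represents f F ∧ E.norm f ≤ E.norm g := by
  have hm : AEStronglyMeasurable (fun t => (F t).toReal) halfLine :=
    hF.ennreal_toReal.aestronglyMeasurable
  obtain ⟨hf, hle⟩ := E.ideal g (AEEqFun.mk _ hm) (by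
    filter_upwards [hFg, AEEqFun.coeFn_mk _ hm] with t ht hmt
    rw [hmt, abs_of_nonneg ENNReal.toReal_nonneg]
    refine (ENNReal.toReal_mono ENNReal.ofReal_ne_top ht).trans ?_
    rw [ENNReal.toReal_ofReal']
    exact max_le (le_abs_self _) (abs_nonneg _))
  refine ⟨⟨_, hf⟩, ?_, hle⟩
  filter_upwards [hFg, AEEqFun.coeFn_mk _ hm] with t ht hmt
  simp only [hmt]
  exact ⟨ENNReal.toReal_nonneg,
    (ENNReal.ofReal_toReal (ht.trans_lt ENNReal.ofReal_lt_top).ne).symm⟩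

theorem eNorm_le_mul {F G : ℝ → ℝ≥0∞} (hF : AEMeasurable F halfLine) {c : ℝ} (hc : 0 ≤ c)
    (hFG : ∀ᵐ t ∂halfLine, F t ≤ ENNReal.ofReal c * G t) :
    E.eNorm F ≤ ENNReal.ofReal c * E.eNorm G := by
  -- For `c = 0` the right side is zero even if `G` has infinite norm, so `F` is shown to represent
  -- an element of norm zero.
  rcases hc.eq_or_lt with rfl | hc0
  · have h0 : ∀ᵐ t ∂halfLine, F t ≤
        ENNReal.ofReal (((0 : E.carrier) : ℝ →ₘ[halfLine] ℝ) t) := by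
      filter_upwards [hFG] with t ht
      simp only [ENNReal.ofReal_zero, zero_mul] at ht
      exact ht.trans zero_le
    obtain ⟨f, hf, hle⟩ := exists_represents_of_le hF 0 h0
    rw [hf.eNorm_eq, ENNReal.ofReal_zero, zero_mul]
    rw [map_zero] at hle
    rw [ENNReal.ofReal_of_nonpos hle]
  · by_cases hG : E.eNorm G < ∞
    · obtain ⟨g, hg⟩ := mem_of_eNorm_lt_top hG
      obtain ⟨f, hf, hle⟩ := exists_represents_of_le hF (c • g) (by
        filter_upwards [hFG, hg, AEEqFun.coeFn_smul c (g : ℝ →ₘ[halfLine] ℝ)] with t h1 h2 h3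
        rw [Submodule.coe_smul, h3, Pi.smul_apply, smul_eq_mul, ENNReal.ofReal_mul hc, ← h2.2]
        exact h1)
      rw [hf.eNorm_eq, hg.eNorm_eq, ← ENNReal.ofReal_mul hc]
      refine ENNReal.ofReal_le_ofReal (hle.trans (le_of_eq ?_))
      rw [map_smul_eq_mul, Real.norm_of_nonneg hc]
    · rw [not_lt_top_iff.1 hG, ENNReal.mul_top (by simpa using hc0)]
      exact le_top

theorem ae_restrict_Ioc_of_ae_halfLine {p : ℝ → Prop} (h : ∀ᵐ t ∂halfLine, p t) (t : ℝ) :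
    ∀ᵐ s ∂volume.restrict (Ioc 0 t), p s :=
  ae_mono (Measure.restrict_mono Ioc_subset_Ioi_self le_rfl) h

/-- Elements of a Banach function space are integrable near zero. -/
theorem integrableOn_Ioc (g : E.carrier) (t : ℝ) :
    IntegrableOn (g : ℝ →ₘ[halfLine] ℝ) (Ioc 0 t) := by
  obtain ⟨f, h, hf, hh, e⟩ := E.le_sum g g.2
  have hle : volume.restrict (Ioc 0 t) ≤ halfLine :=
    Measure.restrict_mono Ioc_subset_Ioi_self le_rfl
  have hf' : IntegrableOn f (Ioc 0 t) := memLp_one_iff_integrable.1 (hf.mono_measure hle)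
  have hh' : IntegrableOn h (Ioc 0 t) :=
    memLp_one_iff_integrable.1 ((hh.mono_measure hle).mono_exponent le_top)
  refine (hf'.add hh').congr ?_
  have := ae_restrict_Ioc_of_ae_halfLine (AEEqFun.coeFn_add f h) t
  rw [e]
  filter_upwards [this] with s hs using hs.symm

end BanachFunctionSpace

theorem hardyNorm_nonneg (E : BanachFunctionSpace) : 0 ≤ hardyNorm E :=
  Real.sInf_nonneg fun _ h => h.1

/-- The infimum in the operator norm of the Hardy operator is attained. -/
theorem exists_hardy_norm_le {E : BanachFunctionSpace} (hE : HardyBounded E) (f : E.carrier) :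
    ∃ g : E.carrier, ((g : ℝ →ₘ[halfLine] ℝ) =ᵐ[halfLine] hardy (f : ℝ →ₘ[halfLine] ℝ)) ∧
      E.norm g ≤ hardyNorm E * E.norm f := by
  obtain ⟨M₀, hM₀⟩ := hE
  obtain ⟨g, hg, hgM⟩ := hM₀ f
  -- The class of `P f` is unique, so a single `g` obeys every admissible bound and hence their
  -- infimum.
  have hbound : ∀ M, IsHardyBound E M → E.norm g ≤ M * E.norm f := fun M hM => by
    obtain ⟨g', hg', hle⟩ := hM f
    have : g = g' := Subtype.ext (AEEqFun.ext (hg.trans hg'.symm))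
    rwa [this]
  refine ⟨g, hg, ?_⟩
  rcases (apply_nonneg E.norm f).eq_or_lt with h0 | h0
  · rw [← h0, mul_zero] at hgM ⊢
    exact hgM
  · rw [← div_le_iff₀ h0]
    refine le_csInf ⟨max M₀ 0, le_max_right _ _, fun f' => ?_⟩ fun M hM =>
      (div_le_iff₀ h0).2 (hbound M hM.2)
    obtain ⟨g', hg', hle⟩ := hM₀ f'
    exact ⟨g', hg', hle.trans
      (mul_le_mul_of_nonneg_right (le_max_left _ _) (apply_nonneg E.norm f'))⟩

/-! ### Lower estimate and membership in the closure of the domain -/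

section Comparison

variable {X : Type*} [NormedAddCommGroup X]

theorem aemeasurable_opInterp_integrand (A : Set (X × X)) (x : X) (τ : ℝ) :
    AEMeasurable ((Ioo 0 τ).indicator fun t => opK A x t / ENNReal.ofReal t) halfLine :=
  (((monotone_opK A x).measurable.div ENNReal.measurable_ofReal).indicator
    measurableSet_Ioo).aemeasurable

theorem mem_closure_of_opInterp_lt_top {A : Set (X × X)} (hA : A.Nonempty)
    {E : BanachFunctionSpace} {τ : ℝ} (hτ : 0 < τ) {x : X} (hx : opInterp A E τ x < ∞) :
    x ∈ closure (dom A) := by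
  by_contra hcl
  rw [Metric.mem_closure_iff_infEDist_zero] at hcl
  have hfin : Metric.infEDist x (dom A) ≠ ∞ :=
    ((infEDist_dom_le_opK A x one_pos).trans_lt (opK_lt_top hA x 1)).ne
  set c := (Metric.infEDist x (dom A)).toReal with hc
  have hc0 : 0 < c := ENNReal.toReal_pos hcl hfin
  obtain ⟨g, hg⟩ := BanachFunctionSpace.mem_of_eNorm_lt_top hx
  have hint := (BanachFunctionSpace.integrableOn_Ioc g τ).mono_set Ioo_subset_Ioc_self
  -- A positive distance `c` to the domain would force `c/t ≤ g(t)`, making `1/t` integrable at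
  -- zero.
  have hae : ∀ᵐ t ∂volume.restrict (Ioo 0 τ), ‖t⁻¹‖ ≤ c⁻¹ * (g : ℝ →ₘ[halfLine] ℝ) t := by
    have := ae_mono (Measure.restrict_mono Ioo_subset_Ioc_self le_rfl)
      (BanachFunctionSpace.ae_restrict_Ioc_of_ae_halfLine hg τ)
    filter_upwards [this, ae_restrict_mem measurableSet_Ioo] with t ht htI
    have ht0 : 0 < t := htI.1
    have h1 : ENNReal.ofReal (c / t) ≤ ENNReal.ofReal ((g : ℝ →ₘ[halfLine] ℝ) t) := by
      rw [← ht.2, indicator_of_mem htI, ENNReal.ofReal_div_of_pos ht0, hc,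
        ENNReal.ofReal_toReal hfin]
      exact ENNReal.div_le_div_right (infEDist_dom_le_opK A x ht0) _
    rw [ENNReal.ofReal_le_ofReal_iff ht.1] at h1
    rw [Real.norm_of_nonneg (by positivity), ← div_eq_inv_mul, le_div_iff₀ hc0]
    rwa [div_eq_inv_mul] at h1
  have hinv : IntegrableOn (fun t : ℝ => t⁻¹) (Ioo 0 τ) :=
    (hint.const_mul c⁻¹).mono' measurable_inv.aestronglyMeasurable hae
  have := (intervalIntegrable_iff_integrableOn_Ioo_of_le hτ.le).2 hinv
  rw [intervalIntegrable_inv_iff] at this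
  rcases this with h | h
  · exact hτ.ne h
  · exact h left_mem_uIcc

variable [NormedSpace ℝ X]

theorem opK_div_le_add_hardy [CompleteSpace X] {ω : ℝ} (hω : 0 ≤ ω) {A : Set (X × X)}
    (hA : IsAccretive ω A) {u : ℝ → X} {x : X} (hu : IsMildSolution A x u)
    {E : BanachFunctionSpace} {τ : ℝ} {g : E.carrier}
    (hg : E.Represents g ((Ioo 0 τ).indicator fun t => setNorm A (u t))) {t : ℝ}
    (ht : t ∈ Ioo 0 τ) :
    opK A x t / ENNReal.ofReal t ≤
      setNorm A (u t) + ENNReal.ofReal (hardy (g : ℝ →ₘ[halfLine] ℝ) t) := by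
  have ht0 : 0 < t := ht.1
  have hae := BanachFunctionSpace.ae_restrict_Ioc_of_ae_halfLine hg t
  have h1 : ∫⁻ s in Ioc 0 t, setNorm A (u s) =
      ENNReal.ofReal (∫ s in Ioc 0 t, (g : ℝ →ₘ[halfLine] ℝ) s) := by
    rw [ofReal_integral_eq_lintegral_ofReal (BanachFunctionSpace.integrableOn_Ioc g t)
      (hae.mono fun s hs => hs.1)]
    refine lintegral_congr_ae ?_
    filter_upwards [hae, ae_restrict_mem measurableSet_Ioc] with s hs hsI
    rw [← hs.2, indicator_of_mem (show s ∈ Ioo 0 τ from ⟨hsI.1, hsI.2.trans_lt ht.2⟩)]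
  have h2 := hu.enorm_sub_initial_le_lintegral hω hA ht0
  rw [h1, ← edist_eq_enorm_sub, edist_comm, edist_eq_enorm_sub] at h2
  have h0 : ENNReal.ofReal t ≠ 0 := by simpa using ht0
  refine ENNReal.div_le_of_le_mul' ((opK_le x (u t) t).trans ?_)
  rw [mul_add, add_comm]
  refine add_le_add le_rfl (h2.trans (le_of_eq ?_))
  rw [hardy, intervalIntegral.integral_of_le ht0.le, ← ENNReal.ofReal_mul ht0.le, ← mul_assoc,
    mul_inv_cancel₀ ht0.ne', one_mul]

/-- The class `g + P g` dominates `K(x,t)/t` on `(0,τ)`; off this interval nonnegativity of `g` and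
`P g` suffices. -/
theorem opInterp_le_of_represents [CompleteSpace X] {ω : ℝ} (hω : 0 ≤ ω) {A : Set (X × X)}
    (hA : IsAccretive ω A) {u : ℝ → X} {x : X} (hu : IsMildSolution A x u)
    {E : BanachFunctionSpace} (hE : HardyBounded E) {τ : ℝ} {g : E.carrier}
    (hg : E.Represents g ((Ioo 0 τ).indicator fun t => setNorm A (u t))) :
    opInterp A E τ x ≤ ENNReal.ofReal ((hardyNorm E + 1) * E.norm g) := by
  obtain ⟨p, hp, hpn⟩ := exists_hardy_norm_le hE g
  have hae : ∀ᵐ t ∂halfLine, 0 ≤ hardy (g : ℝ →ₘ[halfLine] ℝ) t := by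
    filter_upwards [ae_restrict_mem measurableSet_Ioi] with t ht
    have ht0 : 0 < t := ht
    rw [hardy, intervalIntegral.integral_of_le ht0.le]
    exact mul_nonneg (by positivity) (integral_nonneg_of_ae
      ((BanachFunctionSpace.ae_restrict_Ioc_of_ae_halfLine hg t).mono fun s hs => hs.1))
  obtain ⟨f, hf, hle⟩ := BanachFunctionSpace.exists_represents_of_le
    (aemeasurable_opInterp_integrand A x τ) (g + p) (by
      filter_upwards [hg, hp, hae, AEEqFun.coeFn_add (g : ℝ →ₘ[halfLine] ℝ) p] with t h1 h2 h3 h4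
      rw [Submodule.coe_add, h4, Pi.add_apply, h2, ENNReal.ofReal_add h1.1 h3, ← h1.2]
      by_cases ht : t ∈ Ioo 0 τ
      · rw [indicator_of_mem ht, indicator_of_mem ht]
        exact opK_div_le_add_hardy hω hA hu hg ht
      · rw [indicator_of_notMem ht]
        exact zero_le)
  refine (le_of_eq hf.eNorm_eq).trans (ENNReal.ofReal_le_ofReal ?_)
  linarith [hle, map_add_le_add E.norm g p]

end Comparison

theorem IsMAccretive.nonempty {X : Type*} [NormedAddCommGroup X] [NormedSpace ℝ X] {ω : ℝ}
    {A : Set (X × X)} (hA : IsMAccretive ω A) : A.Nonempty := by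
  have h0 : 0 < |ω| + 1 := by positivity
  obtain ⟨p, hp, _⟩ := hA.2 (|ω| + 1)⁻¹ (inv_pos.2 h0) (by
    rw [← div_eq_inv_mul, div_lt_one h0]
    linarith [le_abs_self ω]) 0
  exact ⟨p, hp⟩

end NonlinearInterpolation

/-! ### The norm equivalence -/

theorem mainTheorem9 (ω C τ₀ τ : ℝ) (hC : 0 ≤ C) (hτ₀ : 0 < τ₀) (hτ : 0 < τ) :
    ∃ M : ℝ, 0 < M ∧
      ∀ (X : Type*) [NormedAddCommGroup X] [NormedSpace ℝ X] [CompleteSpace X]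
        (A : Set (X × X)) (S : ℝ → X → X) (E : NonlinearInterpolation.BanachFunctionSpace),
        NonlinearInterpolation.IsMAccretive ω A →
        NonlinearInterpolation.IsGeneratedBy A S →
        NonlinearInterpolation.IsRegularizingWith A S C τ₀ →
        (∀ x ∈ closure (NonlinearInterpolation.dom A),
          AEMeasurable (fun t => NonlinearInterpolation.setNorm A (S t x))
            NonlinearInterpolation.halfLine) →
        NonlinearInterpolation.HardyBounded E →
        (∀ x ∈ closure (NonlinearInterpolation.dom A),
          ENNReal.ofReal
              (1 / (Real.exp (max ω 0 * τ) * NonlinearInterpolation.hardyNorm E + 1)) *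
              NonlinearInterpolation.opInterp A E τ x ≤
            E.eNorm (NonlinearInterpolation.orbitNorm A S τ x) ∧
          E.eNorm (NonlinearInterpolation.orbitNorm A S τ x) ≤
            ENNReal.ofReal M * NonlinearInterpolation.opInterp A E τ x ∧
          (τ ≤ τ₀ →
            E.eNorm (NonlinearInterpolation.orbitNorm A S τ x) ≤
              ENNReal.ofReal C * NonlinearInterpolation.opInterp A E τ x)) ∧
        {x : X | NonlinearInterpolation.opInterp A E τ x < ∞} =
          {x : X | x ∈ closure (NonlinearInterpolation.dom A) ∧
            E.Mem (NonlinearInterpolation.orbitNorm A S τ x)} := by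
  obtain ⟨M, hM, hMle⟩ := NonlinearInterpolation.exists_setNorm_orbit_le ω C τ₀ τ hC hτ₀ hτ
  refine ⟨M, hM, fun X _ _ _ A S E hA hS hR hmeas hE => ?_⟩
  have hA' : NonlinearInterpolation.IsAccretive (max ω 0) A := hA.1.mono (le_max_left _ _)
  have hP := NonlinearInterpolation.hardyNorm_nonneg E
  have hden : 0 < Real.exp (max ω 0 * τ) * NonlinearInterpolation.hardyNorm E + 1 := by
    positivity
  have horb : ∀ x ∈ closure (NonlinearInterpolation.dom A),
      AEMeasurable (NonlinearInterpolation.orbitNorm A S τ x)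
        NonlinearInterpolation.halfLine := fun x hx => (hmeas x hx).indicator measurableSet_Ioo
  have hupper : ∀ x ∈ closure (NonlinearInterpolation.dom A), ∀ c : ℝ, 0 ≤ c →
      (∀ t ∈ Ioo 0 τ, NonlinearInterpolation.setNorm A (S t x) ≤
        ENNReal.ofReal c * (NonlinearInterpolation.opK A x t / ENNReal.ofReal t)) →
      E.eNorm (NonlinearInterpolation.orbitNorm A S τ x) ≤
        ENNReal.ofReal c * NonlinearInterpolation.opInterp A E τ x := fun x hx c hc hle => by
    refine NonlinearInterpolation.BanachFunctionSpace.eNorm_le_mul (horb x hx) hc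
      (Eventually.of_forall fun t => ?_)
    by_cases ht : t ∈ Ioo 0 τ
    · rw [NonlinearInterpolation.orbitNorm, indicator_of_mem ht, indicator_of_mem ht]
      exact hle t ht
    · rw [NonlinearInterpolation.orbitNorm, indicator_of_notMem ht]
      exact zero_le
  have hlower : ∀ x ∈ closure (NonlinearInterpolation.dom A), ∀ g : E.carrier,
      E.Represents g (NonlinearInterpolation.orbitNorm A S τ x) →
      NonlinearInterpolation.opInterp A E τ x ≤
        ENNReal.ofReal ((NonlinearInterpolation.hardyNorm E + 1) * E.norm g) :=
    fun x hx g hg => NonlinearInterpolation.opInterp_le_of_represents (le_max_right ω 0) hA'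
      (hS x hx) hE hg
  refine ⟨fun x hx => ⟨?_, hupper x hx M hM.le (hMle X A S hA.1 hS hR x hx), fun hττ₀ =>
    hupper x hx C hC fun t ht => hR.2 t ⟨ht.1, ht.2.trans_le hττ₀⟩ x hx⟩, ?_⟩
  · by_cases hfin : E.eNorm (NonlinearInterpolation.orbitNorm A S τ x) < ∞
    · obtain ⟨g, hg⟩ := NonlinearInterpolation.BanachFunctionSpace.mem_of_eNorm_lt_top hfin
      rw [hg.eNorm_eq]
      refine (mul_le_mul_right (hlower x hx g hg) _).trans ?_
      rw [← ENNReal.ofReal_mul (by positivity)]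
      refine ENNReal.ofReal_le_ofReal ?_
      rw [one_div, ← div_eq_inv_mul, div_le_iff₀ hden, mul_comm (E.norm g)]
      refine mul_le_mul_of_nonneg_right (add_le_add_left ?_ 1) (apply_nonneg E.norm g)
      -- The argument gives the sharper constant `1 / (‖P‖ + 1)`; the exponential only weakens it.
      exact le_mul_of_one_le_left hP (Real.one_le_exp (by positivity))
    · rw [not_lt_top_iff.1 hfin]
      exact le_top
  · ext x
    constructor
    · intro hx
      have hcl := NonlinearInterpolation.mem_closure_of_opInterp_lt_top hA.nonempty hτ hx
      refine ⟨hcl, NonlinearInterpolation.BanachFunctionSpace.mem_of_eNorm_lt_top ?_⟩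
      exact (hupper x hcl M hM.le (hMle X A S hA.1 hS hR x hcl)).trans_lt
        (ENNReal.mul_lt_top ENNReal.ofReal_lt_top hx)
    · rintro ⟨hcl, g, hg⟩
      exact (hlower x hcl g hg).trans_lt ENNReal.ofReal_lt_top
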